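/- Let $Z$ be a smooth manifold of dimension $n+m$ and $i : X \hookrightarrow Z$ an embedded smooth submanifold of dimension $n$. Let $J^2(Z)\to Z$ be the bundle of 2-jets of functions, with fibre $J^2_z(Z)$ the germs of smooth functions at $z$ modulo those vanishing to order three; every function $\varphi$ that is $C^2$ near $z$ has a 2-jet $J^2_z\varphi \in J^2_z(Z)$, and local coordinates identify $J^2_z(Z)$ with $\mathbf R\times\mathbf R^{n+m}\times \mathrm{Sym}^2(\mathbf R^{n+m})$ by $J^2_z\varphi=(\varphi(z),D\varphi(z),D^2\varphi(z))$. A *subequation* on $Z$ is a closed set $F\subset J^2(Z)$ such that, fibrewise, $F+\mathcal P\subset F$ and $F+\mathcal N\subset F$, where $\mathcal P$ is the set of 2-jets of functions with critical value zero and non-negative second derivative and $\mathcal N$ the set of 2-jets of constants $\le 0$, and such that $F=\overline{\mathrm{Int} F}$, $F_z=\overline{\mathrm{Int} F_z}$ and $\mathrm{Int} F_z=(\mathrm{Int} F)_z$ for all $z$. For a manifold $M$ and a set $G\subset J^2(M)$, an upper semicontinuous function $u:M\to[-\infty,\infty)$ is *$G$-subharmonic* if $J^2_z\varphi\in G$ for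 every $z\in M$ and every function $\varphi$, $C^2$ near $z$, with $u\le\varphi$ near $z$ and $u(z)=\varphi(z)$. Let $i^*F\subset J^2(X)$ be the set of restrictions to $X$ of the 2-jets in $F$ at points of $X$, that is, $(i^*F)_x=\{J^2_x(f|_X) : f \text{ is } C^2 \text{ near } x \text{ in } Z,\ J^2_xf\in F_x\}$. Let $F$ be a subequation on $Z$ that satisfies the following *Restriction Hypothesis*: around each point of $X$ there are smooth local coordinates $z=(x,y)\in\mathbf R^n\times\mathbf R^m$ on $Z$ in which $X$ is given by $y=y_0$, such that for every point $(x_0,y_0)$ of $X$ in the coordinate neighbourhood, every $(r_0,p_0,A_0)\in\mathbf R\times\mathbf R^n\times\mathrm{Sym}^2(\mathbf R^n)$, every sequence of numbers $\epsilon>0$ converging to $0$, and all $z_\epsilon=(x_\epsilon,y_\epsilon)$ in the coordinate neighbourhood and $r_\epsilon\in\mathbf R$: if $$\left(r_\epsilon,\ \Big(p_0+A_0(x_\epsilon-x_0),\ \frac{y_\epsilon-y_0}{\epsilon}\Big),\ \begin{pmatrix}A_0&0\\0&\frac1\epsilon I\end{pmatrix}\right)\in F_{z_\epsilon}\ \text{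 for all } \epsilon,$$ $$x_\epsilon\to x_0,\qquad \frac{|y_\epsilon-y_0|^2}{\epsilon}\to0,\qquad r_\epsilon\to r_0,$$ then $(r_0,p_0,A_0)\in(i^*F)_{x_0}$ (in the coordinates $x$ on $X$). Let $u:Z\to[-\infty,\infty)$ be upper semicontinuous and $F$-subharmonic on $Z$. If $i^*F$ is closed in $J^2(X)$, then $u|_X$ is $i^*F$-subharmonic on $X$. If $i^*F$ is not closed, then $u|_X$ is $\overline{i^*F}$-subharmonic on $X$, where $\overline{i^*F}$ is the closure of $i^*F$ in $J^2(X)$. -/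

import Mathlib

open Set Filter Topology Manifold
open scoped ContDiff

namespace ViscosityRestriction

theorem two_le_infty : (2 : WithTop ℕ∞) ≤ ∞ :=
  WithTop.coe_le_coe.2 (le_top : (2 : ℕ∞) ≤ ⊤)

/-! ## Coordinates and 2-jets

`M` is a manifold without boundary modelled on the normed space `E`. -/

section Jets

variable (E : Type*) [NormedAddCommGroup E] [NormedSpace ℝ E]
variable {M : Type*} [TopologicalSpace M] [ChartedSpace E M]
variable {V : Type*} [NormedAddCommGroup V] [NormedSpace ℝ V]

/-- A smooth local coordinate system on `M` with values in `V`: a diffeomorphism of an open subset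
of `M` onto an open subset of `V`. -/
def IsCoordinates (e : OpenPartialHomeomorph M V) : Prop :=
  ContMDiffOn 𝓘(ℝ, E) 𝓘(ℝ, V) ∞ e e.source ∧ ContMDiffOn 𝓘(ℝ, V) 𝓘(ℝ, E) ∞ e.symm e.target

/-- The symmetric bilinear forms on `V`. -/
def Sym2Form (V : Type*) [NormedAddCommGroup V] [NormedSpace ℝ V] :
    Submodule ℝ (V →L[ℝ] V →L[ℝ] ℝ) where
  carrier := {A | ∀ v w, A v w = A w v}
  add_mem' {A B} hA hB v w := by simp [hA v w, hB v w]
  zero_mem' v w := by simp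
  smul_mem' c A hA v w := by simp [hA v w]

/-- The functions that are `C²` near `z`. -/
def C2At (z : M) : Submodule ℝ (M → ℝ) where
  carrier := {f | ContMDiffAt 𝓘(ℝ, E) 𝓘(ℝ, ℝ) 2 f z}
  add_mem' hf hg := ContMDiffAt.add hf hg
  zero_mem' := contMDiffAt_const
  smul_mem' c _ hf :=
    ((contDiff_const_smul (𝕜 := ℝ) (F := ℝ) (n := 2) c).contMDiff.contMDiffAt).comp z hf

/-- The functions, `C²` near `z`, that vanish at `z` to higher than second order. -/
def VanishingAt (z : M) : Submodule ℝ (C2At E z) where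
  carrier := {f | (f : M → ℝ) =o[𝓝 z] fun w => ‖chartAt E z w - chartAt E z z‖ ^ 2}
  add_mem' hf hg := hf.add hg
  zero_mem' := Asymptotics.isLittleO_zero _ _
  smul_mem' c _ hf := hf.const_smul_left c

/-- The space of 2-jets of functions at `z`. Each class contains a smooth function (a quadratic
polynomial in local coordinates), and two smooth functions are in the same class exactly when their
difference vanishes to order three at `z`; so these are also the germs of smooth functions modulo
those vanishing to order three. -/
def JetAt (z : M) : Type _ := C2At E z ⧸ VanishingAt E z

instance (z : M) : AddCommGroup (JetAt E z) :=
  inferInstanceAs (AddCommGroup (C2At E z ⧸ VanishingAt E z))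

instance (z : M) : Module ℝ (JetAt E z) :=
  inferInstanceAs (Module ℝ (C2At E z ⧸ VanishingAt E z))

variable (M) in
/-- The total space of the bundle of 2-jets of functions on `M`. -/
structure JetBundle where
  /-- the base point -/
  base : M
  /-- the 2-jet at the base point -/
  jet : JetAt E base

/-- The 2-jet at `z` of a function that is `C²` near `z`. -/
def jet2 (f : M → ℝ) (z : M) (hf : ContMDiffAt 𝓘(ℝ, E) 𝓘(ℝ, ℝ) 2 f z) : JetAt E z :=
  Submodule.Quotient.mk (p := VanishingAt E z) ⟨f, hf⟩

/-- The quadratic polynomial, in the coordinates `e` centred at `z`, with value `r`, first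
derivative `p` and second derivative `A` at `z`. -/
noncomputable def quad (e : OpenPartialHomeomorph M V) (z : M) (r : ℝ) (p : V →L[ℝ] ℝ)
    (A : Sym2Form V) (w : M) : ℝ :=
  r + p (e w - e z) + (1 / 2) * A.1 (e w - e z) (e w - e z)

variable {E}

theorem IsCoordinates.contMDiffAt_quad {e : OpenPartialHomeomorph M V} (he : IsCoordinates E e)
    {z : M} (hz : z ∈ e.source) (r : ℝ) (p : V →L[ℝ] ℝ) (A : Sym2Form V) :
    ContMDiffAt 𝓘(ℝ, E) 𝓘(ℝ, ℝ) 2 (quad e z r p A) z := by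
  have h1 : ContMDiffAt 𝓘(ℝ, E) 𝓘(ℝ, V) 2 e z :=
    (he.1.contMDiffAt (e.open_source.mem_nhds hz)).of_le two_le_infty
  have h2 : ContDiff ℝ 2 fun v : V =>
      r + p (v - e z) + (1 / 2) * A.1 (v - e z) (v - e z) := by
    fun_prop
  exact h2.contMDiff.contMDiffAt.comp z h1

/-- The 2-jet at `z` whose components in the coordinates `e` are `(r, p, A)`. -/
noncomputable def coordJet {e : OpenPartialHomeomorph M V} (he : IsCoordinates E e) {z : M}
    (hz : z ∈ e.source) (r : ℝ) (p : V →L[ℝ] ℝ) (A : Sym2Form V) : JetAt E z :=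
  jet2 E (quad e z r p A) z (he.contMDiffAt_quad hz r p A)

/-- The topology of the 2-jet bundle: the finest one for which all the coordinate
parametrizations `U × ℝ × E* × Sym²(E*) → J²(M)` are continuous. Coordinate changes being
homeomorphisms, each of these parametrizations is a homeomorphism onto the open set `J²(U)`. -/
noncomputable instance : TopologicalSpace (JetBundle E M) :=
  ⨆ (e : OpenPartialHomeomorph M E) (he : IsCoordinates E e),
    TopologicalSpace.coinduced
      (fun q : e.source × ℝ × (E →L[ℝ] ℝ) × Sym2Form E =>
        (⟨q.1, coordJet he q.1.2 q.2.1 q.2.2.1 q.2.2.2⟩ : JetBundle E M))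
      inferInstance

/-- The fibre over `z` of a subset of the 2-jet bundle. -/
def fibre (F : Set (JetBundle E M)) (z : M) : Set (JetAt E z) :=
  {j | (⟨z, j⟩ : JetBundle E M) ∈ F}

/-- The topology of the fibre `J²_z(M)`, as a subspace of the 2-jet bundle. -/
noncomputable instance (z : M) : TopologicalSpace (JetAt E z) :=
  TopologicalSpace.induced (fun j => (⟨z, j⟩ : JetBundle E M)) inferInstance

/-- The jets of functions with critical value zero and non-negative second derivative
(a condition that does not depend on the coordinates). -/
def positiveJets (z : M) : Set (JetAt E z) :=
  {j | ∃ (e : OpenPartialHomeomorph M E) (he : IsCoordinates E e) (hz : z ∈ e.source)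
    (A : Sym2Form E), (∀ v, 0 ≤ A.1 v v) ∧ j = coordJet he hz 0 0 A}

/-- The jets of the non-positive constant functions. -/
def negativeJets (z : M) : Set (JetAt E z) :=
  {j | ∃ r : ℝ, r ≤ 0 ∧ j = jet2 E (fun _ => r) z contMDiffAt_const}

/-- Subequations of order at most two on `M`: closed subsets of the 2-jet bundle with the
positivity, negativity and topological conditions. -/
structure IsSubequation (F : Set (JetBundle E M)) : Prop where
  isClosed : IsClosed F
  positivity : ∀ z, ∀ j ∈ fibre F z, ∀ k ∈ positiveJets z, j + k ∈ fibre F z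
  negativity : ∀ z, ∀ j ∈ fibre F z, ∀ k ∈ negativeJets z, j + k ∈ fibre F z
  eq_closure_interior : F = closure (interior F)
  fibre_eq_closure_interior : ∀ z, fibre F z = closure (interior (fibre F z))
  interior_fibre : ∀ z, interior (fibre F z) = fibre (interior F) z

/-- `φ` is a test function for `u` at `z` (its values away from `z` play no role). -/
structure IsTestFunction (u : M → EReal) (φ : M → ℝ) (z : M) : Prop where
  le : ∀ᶠ w in 𝓝 z, u w ≤ φ w
  eq : u z = φ z

/-- Upper semicontinuous functions with values in `[-∞, ∞)`. -/
structure IsUSC (u : M → EReal) : Prop where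
  upperSemicontinuous : UpperSemicontinuous u
  lt_top : ∀ z, u z < ⊤

/-- `u` is `F`-subharmonic on `M`. -/
structure IsSubharmonic (F : Set (JetBundle E M)) (u : M → EReal) : Prop where
  usc : IsUSC u
  jet_mem : ∀ (z : M) (φ : M → ℝ) (hφ : ContMDiffAt 𝓘(ℝ, E) 𝓘(ℝ, ℝ) 2 φ z),
    IsTestFunction u φ z → jet2 E φ z hφ ∈ fibre F z

end Jets

/-! ## Restriction to a submanifold -/

section Restriction

variable {E : Type*} [NormedAddCommGroup E] [NormedSpace ℝ E]
variable {E' : Type*} [NormedAddCommGroup E'] [NormedSpace ℝ E']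
variable {X : Type*} [TopologicalSpace X] [ChartedSpace E X]
variable {Z : Type*} [TopologicalSpace Z] [ChartedSpace E' Z]

/-- The set `i*F` of all restrictions to `X` of the 2-jets in `F` at points of `X`: the jets at `x`
of `f ∘ i`, where `f` has its 2-jet at `i x` in `F`. -/
def inducedJets (i : X → Z) (hi : ContMDiff 𝓘(ℝ, E) 𝓘(ℝ, E') ∞ i) (F : Set (JetBundle E' Z)) :
    Set (JetBundle E X) :=
  {j | ∃ (f : Z → ℝ) (hf : ContMDiffAt 𝓘(ℝ, E') 𝓘(ℝ, ℝ) 2 f (i j.base)),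
    jet2 E' f (i j.base) hf ∈ fibre F (i j.base) ∧
    j.jet = jet2 E (f ∘ i) j.base
      (hf.comp j.base ((hi j.base).of_le two_le_infty))}

variable {V W : Type*} [NormedAddCommGroup V] [NormedSpace ℝ V]
  [NormedAddCommGroup W] [InnerProductSpace ℝ W]

/-- The coordinates `z = (x, y)` on `Z` are adapted to `i : X → Z`: where they are defined, `X` is
given by the equation `y = y₀`. -/
structure IsAdapted (i : X → Z) (e : OpenPartialHomeomorph Z (V × W)) (y₀ : W) : Prop where
  isCoordinates : IsCoordinates E' e
  mem_range_iff : ∀ z ∈ e.source, z ∈ range i ↔ (e z).2 = y₀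

/-- The covector `(p, q)` on `V × W`, `q` being identified with a covector on `W` by the inner
product. -/
noncomputable def blockCovector (p : V →L[ℝ] ℝ) (q : W) : V × W →L[ℝ] ℝ :=
  p.comp (ContinuousLinearMap.fst ℝ V W) + (innerSL ℝ q).comp (ContinuousLinearMap.snd ℝ V W)

/-- The symmetric form with block matrix `diag (A, t I)` on `V × W`. -/
noncomputable def blockForm (A : Sym2Form V) (t : ℝ) : Sym2Form (V × W) :=
  ⟨A.1.bilinearComp (ContinuousLinearMap.fst ℝ V W) (ContinuousLinearMap.fst ℝ V W) +
    t • (show W →L[ℝ] W →L[ℝ] ℝ from innerSL ℝ).bilinearComp (ContinuousLinearMap.snd ℝ V W)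
      (ContinuousLinearMap.snd ℝ V W), by
    intro v w
    have h1 : A.1 v.1 w.1 = A.1 w.1 v.1 := A.2 v.1 w.1
    have h2 : inner ℝ v.2 w.2 = inner ℝ w.2 v.2 := real_inner_comm _ _
    simp only [add_apply, smul_apply,
      ContinuousLinearMap.bilinearComp_apply, ContinuousLinearMap.coe_fst',
      ContinuousLinearMap.coe_snd', h1]
    congr 2⟩

/-- The quadratic polynomial on `X`, centred at `x`, with value `r`, first derivative `p` and second
derivative `A` at `x` in the coordinates on `X` given by the `V`-part of `e ∘ i`. If `e` is adapted
to `X`, this `V`-part is indeed a local coordinate system on `X`. -/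
noncomputable def sliceQuad (i : X → Z) (e : OpenPartialHomeomorph Z (V × W)) (x : X) (r : ℝ)
    (p : V →L[ℝ] ℝ) (A : Sym2Form V) (w : X) : ℝ :=
  r + p ((e (i w)).1 - (e (i x)).1) +
    (1 / 2) * A.1 ((e (i w)).1 - (e (i x)).1) ((e (i w)).1 - (e (i x)).1)

theorem contMDiffAt_sliceQuad {i : X → Z} (hi : ContMDiff 𝓘(ℝ, E) 𝓘(ℝ, E') ∞ i)
    {e : OpenPartialHomeomorph Z (V × W)} (he : IsCoordinates E' e) {x : X}
    (hx : i x ∈ e.source) (r : ℝ) (p : V →L[ℝ] ℝ) (A : Sym2Form V) :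
    ContMDiffAt 𝓘(ℝ, E) 𝓘(ℝ, ℝ) 2 (sliceQuad i e x r p A) x := by
  have h1 : ContMDiffAt 𝓘(ℝ, E') 𝓘(ℝ, V × W) 2 e (i x) :=
    (he.1.contMDiffAt (e.open_source.mem_nhds hx)).of_le two_le_infty
  have h0 : ContMDiffAt 𝓘(ℝ, E) 𝓘(ℝ, V × W) 2 (e ∘ i) x :=
    h1.comp x ((hi x).of_le two_le_infty)
  have h2 : ContDiff ℝ 2 fun v : V × W =>
      r + p (v.1 - (e (i x)).1) + (1 / 2) * A.1 (v.1 - (e (i x)).1) (v.1 - (e (i x)).1) := by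
    fun_prop
  exact h2.contMDiff.contMDiffAt.comp x h0

/-- The restriction hypothesis for `F` and `i : X → Z`, in the coordinates `e`, adapted to `X`. -/
def RestrictionHypothesisIn (i : X → Z) (hi : ContMDiff 𝓘(ℝ, E) 𝓘(ℝ, E') ∞ i)
    (F : Set (JetBundle E' Z)) (e : OpenPartialHomeomorph Z (V × W)) (he : IsCoordinates E' e)
    (y₀ : W) : Prop :=
  ∀ (x₀ : X) (hx₀ : i x₀ ∈ e.source) (r₀ : ℝ) (p₀ : V →L[ℝ] ℝ) (A₀ : Sym2Form V)
    (ε : ℕ → ℝ) (z : ℕ → Z) (hz : ∀ k, z k ∈ e.source) (r : ℕ → ℝ),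
    (∀ k, 0 < ε k) → Tendsto ε atTop (𝓝 0) →
    (∀ k, coordJet he (hz k) (r k)
        (blockCovector (p₀ + A₀.1 ((e (z k)).1 - (e (i x₀)).1)) ((ε k)⁻¹ • ((e (z k)).2 - y₀)))
        (blockForm A₀ (ε k)⁻¹) ∈ fibre F (z k)) →
    Tendsto (fun k => (e (z k)).1) atTop (𝓝 (e (i x₀)).1) →
    Tendsto (fun k => ‖(e (z k)).2 - y₀‖ ^ 2 / ε k) atTop (𝓝 0) →
    Tendsto r atTop (𝓝 r₀) →
    jet2 E (sliceQuad i e x₀ r₀ p₀ A₀) x₀ (contMDiffAt_sliceQuad hi he hx₀ r₀ p₀ A₀) ∈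
      fibre (inducedJets i hi F) x₀

variable (V W) in
/-- The restriction hypothesis for `F` and `i : X → Z`: around each point of `X` there are
coordinates adapted to `X` in which it holds. -/
def RestrictionHypothesis (i : X → Z) (hi : ContMDiff 𝓘(ℝ, E) 𝓘(ℝ, E') ∞ i)
    (F : Set (JetBundle E' Z)) : Prop :=
  ∀ x : X, ∃ (e : OpenPartialHomeomorph Z (V × W)) (y₀ : W) (he : IsAdapted (E' := E') i e y₀),
    i x ∈ e.source ∧ RestrictionHypothesisIn i hi F e he.isCoordinates y₀

end Restriction

end ViscosityRestriction

/-! A quadratic function on `X` that touches `u` strictly from above at `x` extends to `Z`, constant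
in `y`, in adapted coordinates `(x, y)`. Adding the penalty `|y - y₀|² / 2ε` and maximizing the
difference on a compact neighbourhood gives contact points that converge to `x` as `ε → 0`, with
`|y - y₀|² / ε → 0`; the jets there lie in `F`, so the restriction hypothesis puts the strict jet in
`i*F`. An arbitrary test function has a jet that becomes strict when `t |x - x₀|² / 2`, `t > 0`, is
added to it; `t → 0` gives the closure. -/

namespace ViscosityRestriction

section ContactPoints

/-- A maximum point `z` of `v - f` on `K` at which `v` has the finite value `r`: a vertical
translate of the graph of `f` touches that of `v` from above at `z`. -/
structure IsContactPoint {T : Type*} (v : T → EReal) (f : T → ℝ) (K : Set T) (z : T) (r : ℝ) :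
    Prop where
  mem : z ∈ K
  eq : v z = r
  le : ∀ w ∈ K, v w ≤ ((f w + (r - f z) : ℝ) : EReal)

/-- The graph of `g` itself touches that of `v` from above at `z₀`, and at no other point of `S`. -/
structure IsStrictContactPoint {T : Type*} (v : T → EReal) (g : T → ℝ) (S : Set T) (z₀ : T) :
    Prop where
  mem : z₀ ∈ S
  eq : v z₀ = g z₀
  lt : ∀ w ∈ S, w ≠ z₀ → v w < g w

theorem IsContactPoint.sub_le_sub {T : Type*} {v : T → EReal} {f : T → ℝ} {K : Set T} {z w : T}
    {r s : ℝ} (hz : IsContactPoint v f K z r) (hw : w ∈ K) (hs : v w = s) : s - f w ≤ r - f z := by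
  have h := hz.le w hw
  rw [hs, EReal.coe_le_coe_iff] at h
  linarith

variable {T : Type*} [TopologicalSpace T] {K : Set T} {v : T → EReal}

theorem eventually_lt_of_upperSemicontinuousWithinAt {γ : Type*} [LinearOrder γ]
    [DenselyOrdered γ] [TopologicalSpace γ] [OrderClosedTopology γ] {f g : T → γ} {a : T}
    (hf : UpperSemicontinuousWithinAt f K a) (hg : ContinuousWithinAt g K a) (hlt : f a < g a) :
    ∀ᶠ w in 𝓝[K] a, f w < g w := by
  obtain ⟨c, hfc, hcg⟩ := exists_between hlt
  filter_upwards [hf c hfc, hg.eventually_const_lt hcg] with w hw₁ hw₂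
  exact hw₁.trans hw₂

theorem upperSemicontinuousOn_sub_coe (hv : UpperSemicontinuousOn v K) {f : T → ℝ}
    (hf : ContinuousOn f K) : UpperSemicontinuousOn (fun w => v w - (f w : EReal)) K := by
  have hneg : ContinuousOn (fun w => ((-f w : ℝ) : EReal)) K :=
    continuous_coe_real_ereal.comp_continuousOn hf.neg
  exact hv.add' hneg.upperSemicontinuousOn fun w _ =>
    EReal.continuousAt_add (Or.inr (EReal.coe_ne_bot (-f w))) (Or.inr (EReal.coe_ne_top (-f w)))

theorem exists_isContactPoint (hK : IsCompact K) (hv : UpperSemicontinuousOn v K)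
    (htop : ∀ w ∈ K, v w < ⊤) {f : T → ℝ} (hf : ContinuousOn f K) {w₀ : T} (hw₀ : w₀ ∈ K)
    (hbot : v w₀ ≠ ⊥) : ∃ z r, IsContactPoint v f K z r := by
  obtain ⟨z, hz, hmax⟩ := (upperSemicontinuousOn_sub_coe hv hf).exists_isMaxOn ⟨w₀, hw₀⟩ hK
  have hle : ∀ w ∈ K, v w ≤ v z - f z + f w := fun w hw =>
    (EReal.sub_le_iff_le_add (Or.inl (EReal.coe_ne_bot _)) (Or.inl (EReal.coe_ne_top _))).1
      (hmax hw)
  have hfinite : v z ≠ ⊥ := fun h => hbot (le_bot_iff.1 (by simpa [h] using hle w₀ hw₀))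
  lift v z to ℝ using ⟨(htop z hz).ne, hfinite⟩ with r hr
  refine ⟨z, r, hz, hr.symm, fun w hw => (hle w hw).trans_eq ?_⟩
  rw [add_comm (f w)]
  norm_cast

end ContactPoints

section Penalization

section Estimates

variable {T : Type*} {K : Set T} {v : T → EReal} {g h : T → ℝ} {z₀ z : T} {ε r : ℝ}

theorem IsContactPoint.penalty_div_le_sub
    (hz : IsContactPoint v (fun w => g w + h w / ε) K z r)
    (hz₀ : IsStrictContactPoint v g (K ∩ {w | h w = 0}) z₀) : h z / ε ≤ r - g z := by
  have hle := hz.sub_le_sub hz₀.mem.1 hz₀.eq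
  have hzero : h z₀ = 0 := hz₀.mem.2
  simp only [hzero, zero_div] at hle
  linarith

theorem IsContactPoint.le_of_penalty_nonneg
    (hz : IsContactPoint v (fun w => g w + h w / ε) K z r) (hε : 0 < ε) (hh : 0 ≤ h z)
    (hz₀ : IsStrictContactPoint v g (K ∩ {w | h w = 0}) z₀) : g z ≤ r :=
  sub_nonneg.1 ((div_nonneg hh hε.le).trans (hz.penalty_div_le_sub hz₀))

end Estimates

variable {T : Type*} [TopologicalSpace T] {K : Set T} {v : T → EReal} {g h : T → ℝ} {z₀ : T}
  {z : ℝ → T} {r : ℝ → ℝ}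

theorem tendsto_penalty (hK : IsCompact K) (hv : UpperSemicontinuousOn v K)
    (htop : ∀ w ∈ K, v w < ⊤) (hg : Continuous g) (hpos : ∀ w, 0 ≤ h w)
    (hz₀ : IsStrictContactPoint v g (K ∩ {w | h w = 0}) z₀)
    (hz : ∀ ε > 0, IsContactPoint v (fun w => g w + h w / ε) K (z ε) (r ε)) :
    Tendsto (fun ε => h (z ε)) (𝓝[>] 0) (𝓝 0) := by
  obtain ⟨a, s, ha⟩ :=
    exists_isContactPoint hK hv htop hg.continuousOn hz₀.mem.1 (by simp [hz₀.eq])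
  have hbound : ∀ᶠ ε in 𝓝[>] (0 : ℝ), h (z ε) ≤ (s - g a) * ε := by
    filter_upwards [self_mem_nhdsWithin] with ε hε
    rw [← div_le_iff₀ hε]
    exact ((hz ε hε).penalty_div_le_sub hz₀).trans (ha.sub_le_sub (hz ε hε).mem (hz ε hε).eq)
  refine squeeze_zero' (Eventually.of_forall fun ε => hpos _) hbound ?_
  exact ((continuous_const_mul (s - g a)).tendsto' 0 0 (mul_zero _)).mono_left nhdsWithin_le_nhds

theorem tendsto_contactPoint (hK : IsCompact K) (hv : UpperSemicontinuousOn v K)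
    (htop : ∀ w ∈ K, v w < ⊤) (hg : Continuous g) (hh : Continuous h) (hpos : ∀ w, 0 ≤ h w)
    (hz₀ : IsStrictContactPoint v g (K ∩ {w | h w = 0}) z₀)
    (hz : ∀ ε > 0, IsContactPoint v (fun w => g w + h w / ε) K (z ε) (r ε)) :
    Tendsto z (𝓝[>] 0) (𝓝 z₀) := by
  have hmem : ∀ᶠ ε in 𝓝[>] (0 : ℝ), z ε ∈ K := by
    filter_upwards [self_mem_nhdsWithin] with ε hε using (hz ε hε).mem
  refine hK.tendsto_nhds_of_unique_mapClusterPt hmem fun a ha hcluster => ?_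
  by_contra hne
  have hpenalty := tendsto_penalty hK hv htop hg hpos hz₀ hz
  have hzero : h a = 0 :=
    eq_of_nhds_neBot (ClusterPt.mono (hcluster.continuousAt_comp hh.continuousAt) hpenalty)
  have hlt := eventually_nhdsWithin_iff.1 <| eventually_lt_of_upperSemicontinuousWithinAt (hv a ha)
    (continuous_coe_real_ereal.comp hg).continuousWithinAt (hz₀.lt a ⟨ha, hzero⟩ hne)
  obtain ⟨ε, hε, hεpos⟩ := ((hcluster.frequently hlt).and_eventually self_mem_nhdsWithin).exists
  have hrg := hε (hz ε hεpos).mem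
  simp only [(hz ε hεpos).eq, Function.comp_apply, EReal.coe_lt_coe_iff] at hrg
  exact hrg.not_ge ((hz ε hεpos).le_of_penalty_nonneg hεpos (hpos _) hz₀)

theorem tendsto_contact_value_sub (hv : UpperSemicontinuousOn v K) (hg : Continuous g)
    (hpos : ∀ w, 0 ≤ h w) (hz₀ : IsStrictContactPoint v g (K ∩ {w | h w = 0}) z₀)
    (hz : ∀ ε > 0, IsContactPoint v (fun w => g w + h w / ε) K (z ε) (r ε))
    (hlim : Tendsto z (𝓝[>] 0) (𝓝 z₀)) :
    Tendsto (fun ε => r ε - g (z ε)) (𝓝[>] 0) (𝓝 0) := by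
  have hnonneg : ∀ᶠ ε in 𝓝[>] (0 : ℝ), 0 ≤ r ε - g (z ε) := by
    filter_upwards [self_mem_nhdsWithin] with ε hε
    exact sub_nonneg.2 ((hz ε hε).le_of_penalty_nonneg hε (hpos _) hz₀)
  refine tendsto_order.2
    ⟨fun a ha => hnonneg.mono fun ε hε => ha.trans_le hε, fun η hη => ?_⟩
  have hlt : v z₀ < ((g z₀ + η : ℝ) : EReal) := by
    rw [hz₀.eq, EReal.coe_lt_coe_iff]
    exact lt_add_of_pos_right _ hη
  have hnear := eventually_nhdsWithin_iff.1 <| eventually_lt_of_upperSemicontinuousWithinAt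
    (hv z₀ hz₀.mem.1)
    (continuous_coe_real_ereal.comp (hg.add_const η)).continuousWithinAt hlt
  filter_upwards [hlim.eventually hnear, self_mem_nhdsWithin] with ε hε hεpos
  have hrg := hε (hz ε hεpos).mem
  simp only [(hz ε hεpos).eq, Function.comp_apply, EReal.coe_lt_coe_iff] at hrg
  exact sub_left_lt_of_lt_add hrg

theorem tendsto_contact_value (hv : UpperSemicontinuousOn v K) (hg : Continuous g)
    (hpos : ∀ w, 0 ≤ h w) (hz₀ : IsStrictContactPoint v g (K ∩ {w | h w = 0}) z₀)
    (hz : ∀ ε > 0, IsContactPoint v (fun w => g w + h w / ε) K (z ε) (r ε))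
    (hlim : Tendsto z (𝓝[>] 0) (𝓝 z₀)) : Tendsto r (𝓝[>] 0) (𝓝 (g z₀)) := by
  simpa using (tendsto_contact_value_sub hv hg hpos hz₀ hz hlim).add ((hg.tendsto z₀).comp hlim)

theorem tendsto_penalty_div (hv : UpperSemicontinuousOn v K) (hg : Continuous g)
    (hpos : ∀ w, 0 ≤ h w) (hz₀ : IsStrictContactPoint v g (K ∩ {w | h w = 0}) z₀)
    (hz : ∀ ε > 0, IsContactPoint v (fun w => g w + h w / ε) K (z ε) (r ε))
    (hlim : Tendsto z (𝓝[>] 0) (𝓝 z₀)) :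
    Tendsto (fun ε => h (z ε) / ε) (𝓝[>] 0) (𝓝 0) := by
  refine squeeze_zero' ?_ ?_ (tendsto_contact_value_sub hv hg hpos hz₀ hz hlim)
  · filter_upwards [self_mem_nhdsWithin] with ε hε using div_nonneg (hpos _) (mem_Ioi.1 hε).le
  · filter_upwards [self_mem_nhdsWithin] with ε hε using (hz ε hε).penalty_div_le_sub hz₀

theorem exists_seq_isContactPoint (hK : IsCompact K) (hK₀ : K ∈ 𝓝 z₀)
    (hv : UpperSemicontinuousOn v K) (htop : ∀ w ∈ K, v w < ⊤) (hg : Continuous g)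
    (hh : Continuous h) (hpos : ∀ w, 0 ≤ h w)
    (hz₀ : IsStrictContactPoint v g (K ∩ {w | h w = 0}) z₀) :
    ∃ (ε : ℕ → ℝ) (z : ℕ → T) (r : ℕ → ℝ), (∀ k, 0 < ε k) ∧ (∀ k, K ∈ 𝓝 (z k)) ∧
      (∀ k, IsContactPoint v (fun w => g w + h w / ε k) K (z k) (r k)) ∧
      Tendsto ε atTop (𝓝 0) ∧ Tendsto z atTop (𝓝 z₀) ∧
      Tendsto (fun k => h (z k) / ε k) atTop (𝓝 0) ∧ Tendsto r atTop (𝓝 (g z₀)) := by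
  have hexists (ε : ℝ) : ∃ z r, IsContactPoint v (fun w => g w + h w / ε) K z r :=
    exists_isContactPoint hK hv htop (hg.add (hh.div_const ε)).continuousOn hz₀.mem.1
      (by simp [hz₀.eq])
  choose z r hz using hexists
  have hlim := tendsto_contactPoint hK hv htop hg hh hpos hz₀ fun ε _ => hz ε
  have hpenalty := tendsto_penalty_div hv hg hpos hz₀ (fun ε _ => hz ε) hlim
  have hvalue := tendsto_contact_value hv hg hpos hz₀ (fun ε _ => hz ε) hlim
  obtain ⟨ε, hε, hεK⟩ := exists_seq_forall_of_frequently
    ((hlim.eventually (eventually_mem_nhds_iff.2 hK₀)).and self_mem_nhdsWithin).frequently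
  exact ⟨ε, z ∘ ε, r ∘ ε, fun k => (hεK k).2, fun k => (hεK k).1, fun k => hz (ε k),
    tendsto_nhds_of_tendsto_nhdsWithin hε, hlim.comp hε, hpenalty.comp hε, hvalue.comp hε⟩

end Penalization

section Quadratic

open Asymptotics

variable {V : Type*} [NormedAddCommGroup V] [NormedSpace ℝ V]

/-- The quadratic polynomial on `V` with value `r`, first derivative `p` and second derivative `A`
at `a`; in coordinates `e` on a manifold it represents the functions `quad` and `sliceQuad`. -/
noncomputable def quadratic (a : V) (r : ℝ) (p : V →L[ℝ] ℝ) (A : Sym2Form V) (v : V) : ℝ :=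
  r + p (v - a) + (1 / 2) * A.1 (v - a) (v - a)

theorem continuous_quadratic (a : V) (r : ℝ) (p : V →L[ℝ] ℝ) (A : Sym2Form V) :
    Continuous (quadratic a r p A) := by
  unfold quadratic
  fun_prop

theorem quadratic_self (a : V) (r : ℝ) (p : V →L[ℝ] ℝ) (A : Sym2Form V) :
    quadratic a r p A a = r := by
  simp [quadratic]

theorem quadratic_add_smul (a : V) (r r' t : ℝ) (p p' : V →L[ℝ] ℝ) (A A' : Sym2Form V) (v : V) :
    quadratic a (r + t * r') (p + t • p') (A + t • A') v =
      quadratic a r p A v + t * quadratic a r' p' A' v := by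
  simp only [quadratic, Submodule.coe_add, Submodule.coe_smul, add_apply, smul_apply, smul_eq_mul]
  ring

theorem quadratic_recenter (a c : V) (r s : ℝ) (p : V →L[ℝ] ℝ) (A : Sym2Form V) (v : V) :
    quadratic c s (p + A.1 (c - a)) A v =
      quadratic a r p A v + (s - quadratic a r p A c) := by
  have hsub : v - c = (v - a) - (c - a) := by abel
  have hsymm := A.2 (c - a) (v - a)
  simp only [quadratic, hsub, map_sub, sub_apply, add_apply] at hsymm ⊢
  linarith

/-- The second derivative of `f` at `a`. -/
noncomputable def sndDeriv {f : V → ℝ} {a : V} (hf : ContDiffAt ℝ 2 f a) : Sym2Form V :=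
  ⟨fderiv ℝ (fderiv ℝ f) a, fun v w => hf.isSymmSndFDerivAt (by simp) v w⟩

theorem hasFDerivAt_quadratic (a : V) (r : ℝ) (p : V →L[ℝ] ℝ) (A : Sym2Form V) (v : V) :
    HasFDerivAt (quadratic a r p A) (p + A.1 (v - a)) v := by
  have hsub : HasFDerivAt (fun v : V => v - a) (ContinuousLinearMap.id ℝ V) v :=
    (hasFDerivAt_id v).sub_const a
  have hquad := ((A.1.hasFDerivAt.comp v hsub).clm_apply hsub).const_mul (1 / 2)
  refine (((p.hasFDerivAt.comp v hsub).const_add r).add hquad).congr_fderiv ?_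
  ext w
  have hsymm := A.2 w (v - a)
  simp only [ContinuousLinearMap.comp_id, Function.comp_apply, map_sub, add_apply, smul_apply,
    sub_apply, smul_eq_mul, ContinuousLinearMap.flip_apply] at hsymm ⊢
  linarith

theorem taylor_two_isLittleO {f : V → ℝ} {a : V} (hf : ContDiffAt ℝ 2 f a) :
    (fun v => f v - quadratic a (f a) (fderiv ℝ f a) (sndDeriv hf) v) =o[𝓝 a]
      fun v => ‖v - a‖ ^ 2 := by
  have hderiv : HasFDerivAt (fderiv ℝ f) (sndDeriv hf).1 a :=
    ((hf.fderiv_right (m := 1) (by norm_num)).differentiableAt (by norm_num)).hasFDerivAt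
  have hdiff : ∀ᶠ v in 𝓝 a, DifferentiableAt ℝ f v :=
    (hf.eventually (by simp)).mono fun v hv => hv.differentiableAt (by norm_num)
  obtain ⟨ρ, hρ, hball⟩ := Metric.eventually_nhds_iff_ball.1 hdiff
  have hnhds := Metric.isOpen_ball.nhdsWithin_eq (Metric.mem_ball_self (x := a) hρ)
  have hremainder := (convex_ball a ρ).isLittleO_pow_succ (n := 1) (Metric.mem_ball_self hρ)
    (fun v hv => ((hball v hv).hasFDerivAt.sub
      (hasFDerivAt_quadratic a (f a) (fderiv ℝ f a) (sndDeriv hf) v)).hasFDerivWithinAt)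
    (by simpa [hnhds, sub_sub] using hderiv.isLittleO.norm_right)
  simpa [hnhds, quadratic_self] using hremainder

/-- The inner product as a symmetric form, i.e. the second derivative of `v ↦ ‖v‖² / 2`. -/
noncomputable def innerForm (H : Type*) [NormedAddCommGroup H] [InnerProductSpace ℝ H] :
    Sym2Form H :=
  ⟨innerSL ℝ, fun v w => real_inner_comm w v⟩

theorem quadratic_innerForm {H : Type*} [NormedAddCommGroup H] [InnerProductSpace ℝ H] (a v : H) :
    quadratic a 0 0 (innerForm H) v = (1 / 2) * ‖v - a‖ ^ 2 := by
  have hself : (innerForm H).1 (v - a) (v - a) = ‖v - a‖ ^ 2 := real_inner_self_eq_norm_sq (v - a)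
  simp only [quadratic, zero_apply, add_zero, zero_add, hself]

end Quadratic

section Block

variable {V W : Type*} [NormedAddCommGroup V] [NormedSpace ℝ V] [NormedAddCommGroup W]
  [InnerProductSpace ℝ W]

theorem blockCovector_apply (p : V →L[ℝ] ℝ) (q : W) (a : V × W) :
    blockCovector p q a = p a.1 + inner ℝ q a.2 :=
  rfl

theorem blockForm_apply (A : Sym2Form V) (t : ℝ) (a b : V × W) :
    (blockForm A t : Sym2Form (V × W)).1 a b = A.1 a.1 b.1 + t * inner ℝ a.2 b.2 :=
  rfl

theorem blockCovector_add_blockForm (p : V →L[ℝ] ℝ) (A : Sym2Form V) (t : ℝ) (a : V × W) :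
    blockCovector p (0 : W) + (blockForm A t : Sym2Form (V × W)).1 a =
      blockCovector (p + A.1 a.1) (t • a.2) := by
  ext v <;> simp [blockCovector_apply, blockForm_apply, real_inner_smul_left]

theorem quadratic_blockForm (a : V × W) (r : ℝ) (p : V →L[ℝ] ℝ) (A : Sym2Form V) (ε : ℝ)
    (v : V × W) :
    quadratic a r (blockCovector p 0) (blockForm A ε⁻¹) v =
      quadratic a.1 r p A v.1 + (1 / 2) * ‖v.2 - a.2‖ ^ 2 / ε := by
  simp only [quadratic, blockCovector_apply, blockForm_apply, inner_zero_left,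
    real_inner_self_eq_norm_sq, Prod.fst_sub, Prod.snd_sub]
  ring

end Block

section Coordinates

open Asymptotics

variable {E : Type*} [NormedAddCommGroup E] [NormedSpace ℝ E]
variable {M : Type*} [TopologicalSpace M] [ChartedSpace E M]
variable {V V' : Type*} [NormedAddCommGroup V] [NormedSpace ℝ V] [NormedAddCommGroup V']
  [NormedSpace ℝ V']

theorem isCoordinates_chartAt [IsManifold 𝓘(ℝ, E) ∞ M] (z : M) : IsCoordinates E (chartAt E z) :=
  ⟨contMDiffOn_of_mem_maximalAtlas (IsManifold.chart_mem_maximalAtlas z),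
    contMDiffOn_symm_of_mem_maximalAtlas (IsManifold.chart_mem_maximalAtlas z)⟩

theorem IsCoordinates.contMDiffAt {e : OpenPartialHomeomorph M V} (he : IsCoordinates E e) {z : M}
    (hz : z ∈ e.source) : ContMDiffAt 𝓘(ℝ, E) 𝓘(ℝ, V) ∞ e z :=
  he.1.contMDiffAt (e.open_source.mem_nhds hz)

theorem IsCoordinates.contMDiffAt_symm {e : OpenPartialHomeomorph M V} (he : IsCoordinates E e)
    {v : V} (hv : v ∈ e.target) : ContMDiffAt 𝓘(ℝ, V) 𝓘(ℝ, E) ∞ e.symm v :=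
  he.2.contMDiffAt (e.open_target.mem_nhds hv)

theorem IsCoordinates.contDiffAt_comp_symm {e : OpenPartialHomeomorph M V}
    (he : IsCoordinates E e) {z : M} (hz : z ∈ e.source) {f : M → V'} {n : WithTop ℕ∞} (hn : n ≤ ∞)
    (hf : ContMDiffAt 𝓘(ℝ, E) 𝓘(ℝ, V') n f z) : ContDiffAt ℝ n (f ∘ e.symm) (e z) :=
  (hf.comp_of_eq ((he.contMDiffAt_symm (e.map_source hz)).of_le hn) (e.left_inv hz)).contDiffAt

theorem IsCoordinates.isBigO_sub {e : OpenPartialHomeomorph M V} {e' : OpenPartialHomeomorph M V'}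
    (he : IsCoordinates E e) (he' : IsCoordinates E e') {z : M} (hz : z ∈ e.source)
    (hz' : z ∈ e'.source) : (fun w => e w - e z) =O[𝓝 z] fun w => e' w - e' z := by
  have hdiff : DifferentiableAt ℝ (e ∘ e'.symm) (e' z) :=
    (he'.contDiffAt_comp_symm hz' le_rfl (he.contMDiffAt hz)).differentiableAt (by simp)
  refine (hdiff.isBigO_sub.comp_tendsto (e'.continuousAt hz')).congr' ?_ EventuallyEq.rfl
  filter_upwards [e'.open_source.mem_nhds hz'] with w hw
  simp only [Function.comp_apply, e'.left_inv hw, e'.left_inv hz']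

theorem coordJet_add_smul {e : OpenPartialHomeomorph M V} (he : IsCoordinates E e) {z : M}
    (hz : z ∈ e.source) (r r' t : ℝ) (p p' : V →L[ℝ] ℝ) (A A' : Sym2Form V) :
    coordJet he hz (r + t * r') (p + t • p') (A + t • A') =
      coordJet he hz r p A + t • coordJet he hz r' p' A' :=
  congrArg (Submodule.Quotient.mk (p := VanishingAt E z)) <| Subtype.ext <| funext fun w =>
    quadratic_add_smul (e z) r r' t p p' A A' (e w)

theorem continuous_coordJet {e : OpenPartialHomeomorph M E} (he : IsCoordinates E e) {z : M}
    (hz : z ∈ e.source) :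
    Continuous fun q : ℝ × (E →L[ℝ] ℝ) × Sym2Form E =>
      (⟨z, coordJet he hz q.1 q.2.1 q.2.2⟩ : JetBundle E M) := by
  have hbundle : Continuous fun q : e.source × ℝ × (E →L[ℝ] ℝ) × Sym2Form E =>
      (⟨q.1, coordJet he q.1.2 q.2.1 q.2.2.1 q.2.2.2⟩ : JetBundle E M) :=
    continuous_iff_coinduced_le.2 <| le_iSup₂ (f := fun (e : OpenPartialHomeomorph M E)
      (he : IsCoordinates E e) => TopologicalSpace.coinduced
        (fun q : e.source × ℝ × (E →L[ℝ] ℝ) × Sym2Form E =>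
          (⟨q.1, coordJet he q.1.2 q.2.1 q.2.2.1 q.2.2.2⟩ : JetBundle E M)) inferInstance) e he
  exact hbundle.comp (Continuous.prodMk_right ⟨z, hz⟩)

variable [IsManifold 𝓘(ℝ, E) ∞ M]

theorem IsCoordinates.jet2_eq_iff {e : OpenPartialHomeomorph M V} (he : IsCoordinates E e) {z : M}
    (hz : z ∈ e.source) {f g : M → ℝ} (hf : ContMDiffAt 𝓘(ℝ, E) 𝓘(ℝ, ℝ) 2 f z)
    (hg : ContMDiffAt 𝓘(ℝ, E) 𝓘(ℝ, ℝ) 2 g z) :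
    jet2 E f z hf = jet2 E g z hg ↔
      (fun w => f w - g w) =o[𝓝 z] fun w => ‖e w - e z‖ ^ 2 := by
  have hchart := isCoordinates_chartAt (E := E) z
  have hz' := mem_chart_source E z
  refine (Submodule.Quotient.eq (VanishingAt E z)).trans
    ⟨fun h => IsLittleO.trans_isBigO h ?_, fun h => IsLittleO.trans_isBigO h ?_⟩
  · exact (hchart.isBigO_sub he hz' hz).norm_norm.pow 2
  · exact (he.isBigO_sub hchart hz hz').norm_norm.pow 2

theorem IsCoordinates.exists_jet2_eq_coordJet {e : OpenPartialHomeomorph M V}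
    (he : IsCoordinates E e) {z : M} (hz : z ∈ e.source) {f : M → ℝ}
    (hf : ContMDiffAt 𝓘(ℝ, E) 𝓘(ℝ, ℝ) 2 f z) :
    ∃ (p : V →L[ℝ] ℝ) (A : Sym2Form V), jet2 E f z hf = coordJet he hz (f z) p A := by
  have hcomp := he.contDiffAt_comp_symm hz two_le_infty hf
  refine ⟨fderiv ℝ (f ∘ e.symm) (e z), sndDeriv hcomp, (he.jet2_eq_iff hz _ _).2 ?_⟩
  refine (e.symm.isLittleO_congr hz).2 ((taylor_two_isLittleO hcomp).congr' ?_ ?_)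
  all_goals filter_upwards [e.open_target.mem_nhds (e.map_source hz)] with v hv
  · simp only [Function.comp_apply, e.left_inv hz, quad, quadratic, e.right_inv hv]
  · simp only [Function.comp_apply, e.right_inv hv]

set_option maxSynthPendingDepth 3 in
theorem continuous_add_smul_jet {z : M} (j k : JetAt E z) :
    Continuous fun t : ℝ => (⟨z, j + t • k⟩ : JetBundle E M) := by
  have hchart := isCoordinates_chartAt (E := E) z
  have hz := mem_chart_source E z
  obtain ⟨⟨f, hf⟩, rfl⟩ := Submodule.Quotient.mk_surjective _ j
  obtain ⟨⟨g, hg⟩, rfl⟩ := Submodule.Quotient.mk_surjective _ k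
  obtain ⟨p, A, hfjet⟩ := hchart.exists_jet2_eq_coordJet hz hf
  obtain ⟨q, B, hgjet⟩ := hchart.exists_jet2_eq_coordJet hz hg
  have hline : Continuous fun t : ℝ => (f z + t * g z, p + t • q, A + t • B) := by fun_prop
  refine ((continuous_coordJet hchart hz).comp hline).congr fun t => ?_
  simp only [Function.comp_apply, coordJet_add_smul, ← hfjet, ← hgjet]
  rfl

theorem mem_fibre_closure_of_add_smul_mem {S : Set (JetBundle E M)} {z : M} {j k : JetAt E z}
    (h : ∀ t : ℝ, 0 < t → j + t • k ∈ fibre S z) : j ∈ fibre (closure S) z := by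
  have hlim : Tendsto (fun t : ℝ => (⟨z, j + t • k⟩ : JetBundle E M)) (𝓝[>] 0) (𝓝 ⟨z, j⟩) :=
    ((continuous_add_smul_jet j k).tendsto' 0 _ (by simp)).mono_left nhdsWithin_le_nhds
  exact mem_closure_of_tendsto hlim (eventually_nhdsWithin_of_forall h)

theorem IsCoordinates.eventually_lt_quad {H : Type*} [NormedAddCommGroup H] [InnerProductSpace ℝ H]
    {e : OpenPartialHomeomorph M H} (he : IsCoordinates E e) {z : M} (hz : z ∈ e.source)
    {f : M → ℝ} (hf : ContMDiffAt 𝓘(ℝ, E) 𝓘(ℝ, ℝ) 2 f z) {r : ℝ} {p : H →L[ℝ] ℝ} {A : Sym2Form H}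
    (hjet : jet2 E f z hf = coordJet he hz r p A) {t : ℝ} (ht : 0 < t) :
    ∀ᶠ w in 𝓝[≠] z, f w < quad e z r p (A + t • innerForm H) w := by
  have hquad (w : M) : quad e z r p (A + t • innerForm H) w =
      quad e z r p A w + t * ((1 / 2) * ‖e w - e z‖ ^ 2) := by
    have hadd := quadratic_add_smul (e z) r 0 t p 0 A (innerForm H) (e w)
    simp only [mul_zero, smul_zero, add_zero, quadratic_innerForm] at hadd
    exact hadd
  have hsmall := ((he.jet2_eq_iff hz hf _).1 hjet).def (c := t / 4) (by positivity)
  rw [eventually_nhdsWithin_iff]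
  filter_upwards [hsmall, e.open_source.mem_nhds hz] with w hw hws hne
  have hpos : 0 < ‖e w - e z‖ ^ 2 := by
    have := norm_pos_iff.2 (sub_ne_zero.2 (e.injOn.ne hws hz hne))
    positivity
  rw [norm_pow, norm_norm] at hw
  have := (le_abs_self _).trans hw
  rw [hquad]
  nlinarith

end Coordinates

section Slice

variable {E : Type*} [NormedAddCommGroup E] [NormedSpace ℝ E]
variable {E' : Type*} [NormedAddCommGroup E'] [NormedSpace ℝ E']
variable {X Z : Type*} [TopologicalSpace Z] [ChartedSpace E' Z]
variable {V W : Type*} [NormedAddCommGroup V] [NormedSpace ℝ V]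
  [NormedAddCommGroup W] [InnerProductSpace ℝ W]
variable {i : X → Z} {e : OpenPartialHomeomorph Z (V × W)} {y₀ : W}

namespace IsAdapted

theorem prodMk_apply (he : IsAdapted (E' := E') i e y₀) {w : X} (hw : i w ∈ e.source) :
    ((e (i w)).1, y₀) = e (i w) :=
  Prod.ext rfl ((he.mem_range_iff _ hw).1 (mem_range_self w)).symm

theorem symm_mem_range (he : IsAdapted (E' := E') i e y₀) {v : V} (hv : (v, y₀) ∈ e.target) :
    e.symm (v, y₀) ∈ range i :=
  (he.mem_range_iff _ (e.map_target hv)).2 (by rw [e.right_inv hv])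

variable [Nonempty X] [TopologicalSpace X]

/-- The coordinates on `X` given by the `V`-part of adapted coordinates `e`. -/
noncomputable def sliceCoordinates (he : IsAdapted (E' := E') i e y₀) (hi : IsEmbedding i) :
    OpenPartialHomeomorph X V where
  toFun w := (e (i w)).1
  invFun v := Function.invFun i (e.symm (v, y₀))
  source := i ⁻¹' e.source
  target := {v | (v, y₀) ∈ e.target}
  map_source' w hw := by
    rw [mem_ofPred_eq, he.prodMk_apply hw]
    exact e.map_source hw
  map_target' v hv := by
    rw [mem_preimage, Function.invFun_eq (he.symm_mem_range hv)]
    exact e.map_target hv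
  left_inv' w hw := by
    rw [he.prodMk_apply hw, e.left_inv hw, Function.leftInverse_invFun hi.injective]
  right_inv' v hv := by
    rw [Function.invFun_eq (he.symm_mem_range hv), e.right_inv hv]
  open_source := e.open_source.preimage hi.continuous
  open_target := e.open_target.preimage (Continuous.prodMk_left y₀)
  continuousOn_toFun := continuous_fst.comp_continuousOn
    (e.continuousOn.comp hi.continuous.continuousOn fun _ hw => hw)
  continuousOn_invFun := hi.continuousOn_iff.2 <|
    (e.continuousOn_symm.comp (Continuous.prodMk_left y₀).continuousOn fun _ hv => hv).congr
      fun _ hv => Function.invFun_eq (he.symm_mem_range hv)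

theorem apply_sliceCoordinates_symm (he : IsAdapted (E' := E') i e y₀) (hi : IsEmbedding i) {v : V}
    (hv : (v, y₀) ∈ e.target) : i ((he.sliceCoordinates hi).symm v) = e.symm (v, y₀) :=
  Function.invFun_eq (he.symm_mem_range hv)

variable [ChartedSpace E X]

theorem isCoordinates_sliceCoordinates (he : IsAdapted (E' := E') i e y₀)
    (hi : IsSmoothEmbedding 𝓘(ℝ, E) 𝓘(ℝ, E') ∞ i) :
    IsCoordinates E (he.sliceCoordinates hi.isEmbedding) := by
  constructor
  · intro w hw
    exact ((contDiff_fst.contMDiff.contMDiffAt.comp w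
      ((he.isCoordinates.contMDiffAt hw).comp w (hi.contMDiff w)))).contMDiffWithinAt
  · intro v hv
    have htarget := (he.sliceCoordinates hi.isEmbedding).open_target.mem_nhds hv
    refine (ContMDiffAt.iff_comp_isImmersionAt (hi.isImmersion.isImmersionAt _)).2
      ⟨(he.sliceCoordinates hi.isEmbedding).continuousAt_symm hv, ?_⟩ |>.contMDiffWithinAt
    have hincl : ContMDiffAt 𝓘(ℝ, V) 𝓘(ℝ, V × W) ∞ (fun v : V => (v, y₀)) v :=
      (contDiff_id.prodMk contDiff_const).contMDiff.contMDiffAt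
    refine ((he.isCoordinates.contMDiffAt_symm hv).comp v hincl).congr_of_eventuallyEq ?_
    filter_upwards [htarget] with v' hv' using he.apply_sliceCoordinates_symm hi.isEmbedding hv'

end IsAdapted

end Slice

section StrictTestFunctions

theorem IsContactPoint.isTestFunction {M V : Type*} [TopologicalSpace M] [NormedAddCommGroup V]
    [NormedSpace ℝ V] {e : OpenPartialHomeomorph M V} {u : M → EReal} {z : M} (hz : z ∈ e.source)
    {a : V} {r s : ℝ} {p : V →L[ℝ] ℝ} {A : Sym2Form V} {K : Set V}
    (hcontact : IsContactPoint (u ∘ e.symm) (quadratic a r p A) K (e z) s) (hK : K ∈ 𝓝 (e z)) :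
    IsTestFunction u (quad e z s (p + A.1 (e z - a)) A) z where
  le := by
    filter_upwards [(e.continuousAt hz).preimage_mem_nhds hK, e.open_source.mem_nhds hz]
      with w hwK hw
    have hle := hcontact.le (e w) hwK
    rw [Function.comp_apply, e.left_inv hw, ← quadratic_recenter] at hle
    exact hle
  eq := by
    have heq := hcontact.eq
    rw [Function.comp_apply, e.left_inv hz, ← quadratic_self (e z) s (p + A.1 (e z - a)) A] at heq
    exact heq

variable {E : Type*} [NormedAddCommGroup E] [NormedSpace ℝ E]
variable {E' : Type*} [NormedAddCommGroup E'] [NormedSpace ℝ E']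
variable {X : Type*} [TopologicalSpace X]
variable {Z : Type*} [TopologicalSpace Z] [ChartedSpace E' Z]
variable {V W : Type*} [NormedAddCommGroup V] [NormedSpace ℝ V]
  [NormedAddCommGroup W] [InnerProductSpace ℝ W]
variable {i : X → Z} {e : OpenPartialHomeomorph Z (V × W)} {y₀ : W}

theorem IsSubharmonic.coordJet_mem_of_isContactPoint {F : Set (JetBundle E' Z)} {u : Z → EReal}
    (hu : IsSubharmonic F u) (he : IsCoordinates E' e) {z : Z} (hz : z ∈ e.source) {a : V × W}
    {r s ε : ℝ} {p : V →L[ℝ] ℝ} {A : Sym2Form V} {K : Set (V × W)}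
    (hcontact : IsContactPoint (u ∘ e.symm)
      (fun v => quadratic a.1 r p A v.1 + (1 / 2) * ‖v.2 - a.2‖ ^ 2 / ε) K (e z) s)
    (hK : K ∈ 𝓝 (e z)) :
    coordJet he hz s (blockCovector (p + A.1 ((e z).1 - a.1)) (ε⁻¹ • ((e z).2 - a.2)))
      (blockForm A ε⁻¹) ∈ fibre F z := by
  have hcontact' : IsContactPoint (u ∘ e.symm)
      (quadratic a r (blockCovector p 0) (blockForm A ε⁻¹)) K (e z) s := by
    rwa [funext (quadratic_blockForm a r p A ε)]
  have htest := hcontact'.isTestFunction hz hK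
  rw [blockCovector_add_blockForm] at htest
  exact hu.jet_mem z _ (he.contMDiffAt_quad hz _ _ _) htest

theorem IsAdapted.eventually_slice (he : IsAdapted (E' := E') i e y₀) (hi : IsEmbedding i) {x : X}
    (hx : i x ∈ e.source) {P : Z → Prop} (h : ∀ᶠ w in 𝓝[≠] x, P (i w)) :
    ∀ᶠ v in 𝓝 (e (i x)), v.2 = y₀ → v ≠ e (i x) → P (e.symm v) := by
  rw [eventually_nhdsWithin_iff, hi.nhds_eq_comap, eventually_comap] at h
  have hsymm : Tendsto e.symm (𝓝 (e (i x))) (𝓝 (i x)) := e.tendsto_symm hx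
  filter_upwards [hsymm.eventually h, e.open_target.mem_nhds (e.map_source hx)]
    with v hv hvt hslice hne
  have hvt' : (v.1, y₀) ∈ e.target := by rwa [← hslice]
  obtain ⟨w, hw⟩ := he.symm_mem_range hvt'
  rw [← hslice] at hw
  rw [← hw]
  refine hv w hw fun hwx => hne ?_
  rw [← e.right_inv hvt, ← hw, hwx]

theorem IsAdapted.exists_isStrictContactPoint [LocallyCompactSpace V] [LocallyCompactSpace W]
    (he : IsAdapted (E' := E') i e y₀) (hi : IsEmbedding i) {x : X} (hx : i x ∈ e.source)
    {u : Z → EReal} {r : ℝ} {p : V →L[ℝ] ℝ} {A : Sym2Form V} (hux : u (i x) = r)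
    (hlt : ∀ᶠ w in 𝓝[≠] x, u (i w) < sliceQuad i e x r p A w) :
    ∃ K ∈ 𝓝 (e (i x)), IsCompact K ∧ K ⊆ e.target ∧
      IsStrictContactPoint (u ∘ e.symm) (fun v => quadratic (e (i x)).1 r p A v.1)
        (K ∩ {v | (1 / 2) * ‖v.2 - y₀‖ ^ 2 = 0}) (e (i x)) := by
  have hslice := he.eventually_slice hi hx
    (P := fun z => u z < quadratic (e (i x)).1 r p A (e z).1) hlt
  obtain ⟨K, hK, hKsub, hKc⟩ :=
    local_compact_nhds (inter_mem (e.open_target.mem_nhds (e.map_source hx)) hslice)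
  refine ⟨K, hK, hKc, fun v hv => (hKsub hv).1, ⟨mem_of_mem_nhds hK, ?_⟩, ?_, ?_⟩
  · simp [(he.mem_range_iff _ hx).1 (mem_range_self x)]
  · rw [Function.comp_apply, e.left_inv hx, hux, quadratic_self]
  · rintro v ⟨hvK, hv⟩ hne
    have hvy : v.2 = y₀ := by simpa [sub_eq_zero] using hv
    have hvlt := (hKsub hvK).2 hvy hne
    rwa [e.right_inv (hKsub hvK).1] at hvlt

theorem jet2_sliceQuad_mem_of_eventually_lt [ChartedSpace E X] [LocallyCompactSpace V]
    [LocallyCompactSpace W] (hi : IsSmoothEmbedding 𝓘(ℝ, E) 𝓘(ℝ, E') ∞ i)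
    {F : Set (JetBundle E' Z)} (he : IsAdapted (E' := E') i e y₀)
    (hres : RestrictionHypothesisIn i hi.contMDiff F e he.isCoordinates y₀) {u : Z → EReal}
    (hu : IsSubharmonic F u) {x : X} (hx : i x ∈ e.source) {r : ℝ} {p : V →L[ℝ] ℝ} {A : Sym2Form V}
    (hux : u (i x) = r) (hlt : ∀ᶠ w in 𝓝[≠] x, u (i w) < sliceQuad i e x r p A w) :
    jet2 E (sliceQuad i e x r p A) x
        (contMDiffAt_sliceQuad hi.contMDiff he.isCoordinates hx r p A) ∈
      fibre (inducedJets i hi.contMDiff F) x := by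
  obtain rfl : (e (i x)).2 = y₀ := (he.mem_range_iff _ hx).1 (mem_range_self x)
  obtain ⟨K, hK, hKc, hKt, hstrict⟩ := he.exists_isStrictContactPoint hi.isEmbedding hx hux hlt
  have husc : UpperSemicontinuousOn (u ∘ e.symm) K :=
    (hu.usc.upperSemicontinuous.upperSemicontinuousOn univ).comp (e.continuousOn_symm.mono hKt)
      (mapsTo_univ _ _)
  have htop : ∀ v ∈ K, (u ∘ e.symm) v < ⊤ := fun v _ => hu.usc.lt_top _
  obtain ⟨ε, ζ, s, hεpos, hζK, hcontact, hε, hζ, hpenalty, hs⟩ :=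
    exists_seq_isContactPoint hKc hK husc htop ((continuous_quadratic _ r p A).comp continuous_fst)
      (by fun_prop) (fun v => by positivity) hstrict
  have hζt (k : ℕ) : ζ k ∈ e.target := hKt (hcontact k).mem
  refine hres x hx r p A ε (fun k => e.symm (ζ k)) (fun k => e.map_target (hζt k)) s hεpos hε
    (fun k => ?_) ?_ ?_ ?_
  · refine hu.coordJet_mem_of_isContactPoint he.isCoordinates (e.map_target (hζt k)) (K := K)
      (a := e (i x)) (r := r) ?_ ?_
    all_goals rw [e.right_inv (hζt k)]
    exacts [hcontact k, hζK k]
  · simp only [e.right_inv (hζt _)]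
    exact (continuous_fst.tendsto _).comp hζ
  · simp only [e.right_inv (hζt _)]
    simpa [mul_div_assoc] using hpenalty.const_mul 2
  · simpa only [Function.comp_apply, quadratic_self] using hs

end StrictTestFunctions

section Closure

variable {E : Type*} [NormedAddCommGroup E] [NormedSpace ℝ E]
variable {E' : Type*} [NormedAddCommGroup E'] [NormedSpace ℝ E']
variable {X : Type*} [TopologicalSpace X] [ChartedSpace E X] [IsManifold 𝓘(ℝ, E) ∞ X]
variable {Z : Type*} [TopologicalSpace Z] [ChartedSpace E' Z]
variable {V W : Type*} [NormedAddCommGroup V] [InnerProductSpace ℝ V] [LocallyCompactSpace V]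
  [NormedAddCommGroup W] [InnerProductSpace ℝ W] [LocallyCompactSpace W]
variable {i : X → Z}

theorem jet2_mem_closure_inducedJets (hi : IsSmoothEmbedding 𝓘(ℝ, E) 𝓘(ℝ, E') ∞ i)
    {F : Set (JetBundle E' Z)} (hres : RestrictionHypothesis V W i hi.contMDiff F) {u : Z → EReal}
    (hu : IsSubharmonic F u) {x : X} {φ : X → ℝ} (hφ : ContMDiffAt 𝓘(ℝ, E) 𝓘(ℝ, ℝ) 2 φ x)
    (htest : IsTestFunction (u ∘ i) φ x) :
    jet2 E φ x hφ ∈ fibre (closure (inducedJets i hi.contMDiff F)) x := by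
  have : Nonempty X := ⟨x⟩
  obtain ⟨e, y₀, he, hx, hresIn⟩ := hres x
  have hslice := he.isCoordinates_sliceCoordinates hi
  obtain ⟨p, A, hjet⟩ := hslice.exists_jet2_eq_coordJet hx hφ
  refine mem_fibre_closure_of_add_smul_mem (k := coordJet hslice hx 0 0 (innerForm V))
    fun t ht => ?_
  have hlt : ∀ᶠ w in 𝓝[≠] x, u (i w) < sliceQuad i e x (φ x) p (A + t • innerForm V) w := by
    filter_upwards [hslice.eventually_lt_quad hx hφ hjet ht, nhdsWithin_le_nhds htest.le]
      with w hw hle using hle.trans_lt (EReal.coe_lt_coe_iff.2 hw)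
  have hmem := jet2_sliceQuad_mem_of_eventually_lt hi he hresIn hu hx htest.eq hlt
  have hadd := coordJet_add_smul hslice hx (φ x) 0 t p 0 A (innerForm V)
  simp only [mul_zero, smul_zero, add_zero] at hadd
  rwa [hjet, ← hadd]

end Closure

end ViscosityRestriction

open ViscosityRestriction in
theorem theorem9p1p1_general {E E' V W : Type*} [NormedAddCommGroup E] [NormedSpace ℝ E]
    [NormedAddCommGroup E'] [NormedSpace ℝ E'] [NormedAddCommGroup V] [InnerProductSpace ℝ V]
    [LocallyCompactSpace V] [NormedAddCommGroup W] [InnerProductSpace ℝ W] [LocallyCompactSpace W]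
    {X : Type*} [TopologicalSpace X] [ChartedSpace E X] [IsManifold 𝓘(ℝ, E) ∞ X]
    {Z : Type*} [TopologicalSpace Z] [ChartedSpace E' Z] {i : X → Z}
    (hi : IsSmoothEmbedding 𝓘(ℝ, E) 𝓘(ℝ, E') ∞ i) {F : Set (JetBundle E' Z)}
    (hres : RestrictionHypothesis V W i hi.contMDiff F) {u : Z → EReal} (hu : IsSubharmonic F u) :
    (IsClosed (inducedJets i hi.contMDiff F) →
      IsSubharmonic (inducedJets i hi.contMDiff F) (u ∘ i)) ∧
    IsSubharmonic (closure (inducedJets i hi.contMDiff F)) (u ∘ i) := by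
  have hclosure : IsSubharmonic (closure (inducedJets i hi.contMDiff F)) (u ∘ i) :=
    ⟨⟨hu.usc.upperSemicontinuous.comp hi.contMDiff.continuous, fun x => hu.usc.lt_top (i x)⟩,
      fun _ _ hφ htest => jet2_mem_closure_inducedJets hi hres hu hφ htest⟩
  exact ⟨fun hclosed => by rwa [hclosed.closure_eq] at hclosure, hclosure⟩

theorem theorem9p1p1 {n m : ℕ}
    {X : Type*} [TopologicalSpace X] [ChartedSpace (EuclideanSpace ℝ (Fin n)) X]
    [IsManifold 𝓘(ℝ, EuclideanSpace ℝ (Fin n)) ∞ X]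
    {Z : Type*} [TopologicalSpace Z] [ChartedSpace (EuclideanSpace ℝ (Fin (n + m))) Z]
    [IsManifold 𝓘(ℝ, EuclideanSpace ℝ (Fin (n + m))) ∞ Z]
    (i : X → Z)
    (hi : IsSmoothEmbedding 𝓘(ℝ, EuclideanSpace ℝ (Fin n))
      𝓘(ℝ, EuclideanSpace ℝ (Fin (n + m))) ∞ i)
    (F : Set (ViscosityRestriction.JetBundle (EuclideanSpace ℝ (Fin (n + m))) Z))
    (hF : ViscosityRestriction.IsSubequation F)
    (hres : ViscosityRestriction.RestrictionHypothesis (EuclideanSpace ℝ (Fin n))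
      (EuclideanSpace ℝ (Fin m)) i hi.contMDiff F)
    (u : Z → EReal) (hu : ViscosityRestriction.IsSubharmonic F u) :
    (IsClosed (ViscosityRestriction.inducedJets i hi.contMDiff F) →
      ViscosityRestriction.IsSubharmonic
        (ViscosityRestriction.inducedJets i hi.contMDiff F) (u ∘ i)) ∧
    ViscosityRestriction.IsSubharmonic
      (closure (ViscosityRestriction.inducedJets i hi.contMDiff F)) (u ∘ i) := by
  exact theorem9p1p1_general hi hres hu
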